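/- Let $\Omega$ be a finite set of items and $\mathcal B$ a finite set of bidders. Each bidder $b$ has a monotone valuation $v_b : 2^\Omega \to \mathbb R$ with $v_b(\emptyset)=0$. For $p\in\mathbb R^\Omega$ write $p(S)=\sum_{j\in S}p_j$. The demand $D_b(p)$ is the set of all $S\subseteq\Omega$ that maximize $v_b(S)-p(S)$. An allocation is a family $\langle\Omega_b\rangle_{b\in\mathcal B}$ of pairwise disjoint subsets of $\Omega$; items may remain unallocated. It is envy free at $p$ if $\Omega_b\in D_b(p)$ for all $b$. A Walrasian equilibrium (WE) is an allocation that is envy free at prices $p\ge 0$, where $p_j=0$ for every unallocated item $j$. For reserve prices $r\in\mathbb R^\Omega$, $r\ge 0$, a Walrasian equilibrium with reserve prices $r$ ($r$-WE) is an allocation that is envy free at prices $p\ge r$, where $p_j=r_j$ for every unallocated item $j$. Vector inequalities are item-wise. Let $\mathcal B'=\mathcal B\cup\{a\}$, where $a$ is an additional bidder with the additive valuation $v_a(S)=r(S)$. An allocation $\langle\Omega_b\rangle_{b\in\mathcal B}$ is extended to an allocation $\langle\Omega'_{b}\rangle_{b\in\mathcal B'}$ by $\Omega'_b=\Omega_b$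 for $b\in\mathcal B$ and $\Omega'_a=\Omega\setminus\bigcup_{b\in\mathcal B}\Omega_b$. The reserve-price LP is $$\max\ \sum_{b\in\mathcal B,\,S\subseteq\Omega}x_{b,S}\,\bigl(v_b(S)-r(S)\bigr)+\sum_{j\in\Omega}r_j$$ subject to $\sum_{b\in\mathcal B,\,S\ni j}x_{b,S}\le 1$ for all $j\in\Omega$, $\sum_{S\subseteq\Omega}x_{b,S}\le 1$ for all $b\in\mathcal B$, and $x_{b,S}\ge 0$ for all $b\in\mathcal B$, $S\subseteq\Omega$. An allocation is identified with the integral point given by $x_{b,S}=1$ if $S=\Omega_b$ and $x_{b,S}=0$ otherwise. A valuation with demand $D$ is gross substitute if for all price vectors $p^{(2)}\ge p^{(1)}\ge 0$ and every $D^{(1)}\in D(p^{(1)})$ there is $D^{(2)}\in D(p^{(2)})$ that contains every $j\in D^{(1)}$ with $p^{(1)}_j=p^{(2)}_j$. Then for every $r\ge0$: (a1) An allocation $\langle\Omega_b\rangle$ and prices $p$ form an $r$-WE for $\mathcal B$ if and only if there are prices $p'$ such that $\langle\Omega'_b\rangle$ and $p'$ form a WE for $\mathcal B'$, $p_j=p'_j$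 for all $j\in\bigcup_{b\in\mathcal B}\Omega_b$, and $p_j=r_j$ for all $j\in\Omega\setminus\bigcup_{b\in\mathcal B}\Omega_b$. (a2) For an allocation $\langle\Omega_b\rangle$ there are prices with which it forms an $r$-WE if and only if it is an optimal solution of the reserve-price LP (optimal among all feasible points, integral or fractional). (b) If all valuations $v_b$, $b\in\mathcal B$, are gross substitute, then (b1) an $r$-WE exists, and (b2) the set of all $r$-WE price vectors, ordered item-wise, is a complete lattice, in which the meet and the join of every non-empty subset are its item-wise infimum and supremum. -/

import Mathlib

namespace Market

/-- A valuation: a set function on the items with `v ∅ = 0` that is monotone. -/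
structure IsValuation {Ω : Type*} (v : Finset Ω → ℝ) : Prop where
  empty : v ∅ = 0
  mono : ∀ S T : Finset Ω, S ⊆ T → v S ≤ v T

/-- The quasi-linear utility `v(S) - p(S)`, where `p(S) = ∑ j ∈ S, p j`. -/
def utility {Ω : Type*} (v : Finset Ω → ℝ) (p : Ω → ℝ) (S : Finset Ω) : ℝ :=
  v S - ∑ j ∈ S, p j

/-- The demand: all sets of items that maximize the utility at prices `p`. -/
def demand {Ω : Type*} (v : Finset Ω → ℝ) (p : Ω → ℝ) : Set (Finset Ω) :=
  {S | ∀ T : Finset Ω, utility v p T ≤ utility v p S}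

/-- The gross-substitute property. -/
def GrossSubstitute {Ω : Type*} (v : Finset Ω → ℝ) : Prop :=
  ∀ p₁ p₂ : Ω → ℝ, 0 ≤ p₁ → p₁ ≤ p₂ → ∀ D₁ ∈ demand v p₁,
    ∃ D₂ ∈ demand v p₂, ∀ j ∈ D₁, p₁ j = p₂ j → j ∈ D₂

/-- An allocation gives pairwise disjoint sets of items to the bidders; items may stay
unallocated. -/
structure Allocation (B Ω : Type*) where
  bundle : B → Finset Ω
  disjoint : ∀ b b' : B, b ≠ b' → Disjoint (bundle b) (bundle b')

/-- Item `j` is allocated to some bidder. -/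
def Allocation.IsAllocated {B Ω : Type*} (A : Allocation B Ω) (j : Ω) : Prop :=
  ∃ b, j ∈ A.bundle b

/-- Every bidder gets a set in his demand. -/
def EnvyFree {B Ω : Type*} (v : B → Finset Ω → ℝ) (A : Allocation B Ω) (p : Ω → ℝ) : Prop :=
  ∀ b, A.bundle b ∈ demand (v b) p

/-- Walrasian equilibrium. -/
structure IsWE {B Ω : Type*} (v : B → Finset Ω → ℝ) (A : Allocation B Ω) (p : Ω → ℝ) :
    Prop where
  envyFree : EnvyFree v A p
  nonneg : 0 ≤ p
  unallocated : ∀ j, ¬ A.IsAllocated j → p j = 0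

/-- Walrasian equilibrium with reserve prices `r`. -/
structure IsReserveWE {B Ω : Type*} (v : B → Finset Ω → ℝ) (r : Ω → ℝ) (A : Allocation B Ω)
    (p : Ω → ℝ) : Prop where
  envyFree : EnvyFree v A p
  reserve_le : r ≤ p
  unallocated : ∀ j, ¬ A.IsAllocated j → p j = r j

/-- The valuations of the bidders `B' = B ∪ {a}`: the additional bidder `a`, here `none`, is
additive with item values `r`. -/
def extendValuations {B Ω : Type*} (v : B → Finset Ω → ℝ) (r : Ω → ℝ) :
    Option B → Finset Ω → ℝ
  | none => fun S => ∑ j ∈ S, r j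
  | some b => v b

/-- The extension of an allocation to `B' = B ∪ {a}`: the additional bidder `a` gets every item
that is unallocated. -/
def Allocation.extend {B Ω : Type*} [Fintype B] [Fintype Ω] [DecidableEq Ω]
    (A : Allocation B Ω) : Allocation (Option B) Ω where
  bundle
    | none => Finset.univ \ Finset.univ.biUnion A.bundle
    | some b => A.bundle b
  disjoint := by
    have key : ∀ b, Disjoint (Finset.univ \ Finset.univ.biUnion A.bundle) (A.bundle b) :=
      fun b => Finset.sdiff_disjoint.mono_right
        (Finset.subset_biUnion_of_mem A.bundle (Finset.mem_univ b))
    rintro (_ | b) (_ | b') h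
    · exact absurd rfl h
    · exact key b'
    · exact (key b).symm
    · exact A.disjoint b b' (fun e => h (congrArg some e))

/-- The feasible points `x = (x_{b,S})` of the linear programs. -/
structure LPFeasible {B Ω : Type*} [Fintype B] [Fintype Ω] [DecidableEq Ω]
    (x : B → Finset Ω → ℝ) : Prop where
  item : ∀ j : Ω, ∑ b : B, ∑ S : Finset Ω with j ∈ S, x b S ≤ 1
  bidder : ∀ b : B, ∑ S : Finset Ω, x b S ≤ 1
  nonneg : ∀ (b : B) (S : Finset Ω), 0 ≤ x b S

/-- The objective of the reserve-price linear program. -/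
def reserveLPObjective {B Ω : Type*} [Fintype B] [Fintype Ω]
    (v : B → Finset Ω → ℝ) (r : Ω → ℝ) (x : B → Finset Ω → ℝ) : ℝ :=
  ∑ b : B, ∑ S : Finset Ω, x b S * (v b S - ∑ j ∈ S, r j) + ∑ j : Ω, r j

/-- `x` is an optimal solution of the reserve-price linear program, where the competing points
range over all feasible points, fractional ones included. -/
def IsReserveLPOptimal {B Ω : Type*} [Fintype B] [Fintype Ω] [DecidableEq Ω]
    (v : B → Finset Ω → ℝ) (r : Ω → ℝ) (x : B → Finset Ω → ℝ) : Prop :=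
  LPFeasible x ∧ ∀ y : B → Finset Ω → ℝ, LPFeasible y →
    reserveLPObjective v r y ≤ reserveLPObjective v r x

/-- An allocation as an integral point: `x_{b,S} = 1` if `b` gets exactly `S`, and `0`
otherwise. -/
def Allocation.toLP {B Ω : Type*} [DecidableEq Ω] (A : Allocation B Ω) :
    B → Finset Ω → ℝ :=
  fun b S => if S = A.bundle b then 1 else 0

/-- The price vectors in `P` form a complete lattice: every subset of `P`, the empty one included,
has a meet and a join in the poset `P` with the item-wise order. Moreover meets and joins of
non-empty subsets (of two price vectors, in particular) are the item-wise infima and suprema: they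
are greatest lower and least upper bounds among all real vectors. -/
structure FormsCompleteLattice {Ω : Type*} (P : Set (Ω → ℝ)) : Prop where
  complete : ∀ X : Set P, (∃ q : P, IsGLB X q) ∧ ∃ q : P, IsLUB X q
  itemwise : ∀ X : Set (Ω → ℝ), X ⊆ P → X.Nonempty →
    (∃ q ∈ P, IsGLB X q) ∧ ∃ q ∈ P, IsLUB X q

end Market

/-! The theorem is linear programming duality. For `p ≥ r`, `dualObjective v p` (the bidders' best
utilities plus all prices) bounds the reserve LP objective of every feasible point. At an allocation
the gap is the bidders' total shortfall from their best utilities plus the excess of `p` over `r` on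
unallocated items, so it vanishes exactly at an r-WE. This is one half of (a2); for the other half,
a separating hyperplane gives multipliers `w ≥ 0`, and `r + w` closes the gap.

(a1): the additive bidder demands the unallocated items only if prices are at least `r` on allocated
and at most `r` on unallocated items; raising the latter to `r` creates no envy.

(b1): an ascending auction with increment `ε` reaches an allocation with gap at most `|B| |Ω| ε`.
There are finitely many allocations, so letting `ε → 0` shows that the best one is LP optimal, and
(a2) supplies prices.

(b2): once an r-WE exists, the r-WE prices are the minimizers of `dualObjective v` over `p ≥ r`.
Gross substitutes makes this function submodular, so the minimizers form a sublattice of `Ω → ℝ`;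
being closed and bounded, it is complete. -/

namespace Market

/-! ### Weak duality and complementary slackness -/

section General

variable {B Ω : Type*} [Fintype Ω]

/-- The largest utility that is attainable at prices `p`. -/
noncomputable def indirectUtility (v : Finset Ω → ℝ) (p : Ω → ℝ) : ℝ :=
  Finset.univ.sup' Finset.univ_nonempty (utility v p)

theorem utility_le_indirectUtility (v : Finset Ω → ℝ) (p : Ω → ℝ) (S : Finset Ω) :
    utility v p S ≤ indirectUtility v p :=
  Finset.le_sup' (utility v p) (Finset.mem_univ S)

theorem exists_utility_eq_indirectUtility (v : Finset Ω → ℝ) (p : Ω → ℝ) :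
    ∃ S, utility v p S = indirectUtility v p := by
  obtain ⟨S, -, hS⟩ := Finset.exists_mem_eq_sup' Finset.univ_nonempty (utility v p)
  exact ⟨S, hS.symm⟩

theorem mem_demand_iff (v : Finset Ω → ℝ) (p : Ω → ℝ) (S : Finset Ω) :
    S ∈ demand v p ↔ utility v p S = indirectUtility v p := by
  constructor
  · intro h
    obtain ⟨T, hT⟩ := exists_utility_eq_indirectUtility v p
    exact le_antisymm (utility_le_indirectUtility v p S) (hT ▸ h T)
  · intro h T
    exact h ▸ utility_le_indirectUtility v p T

theorem demand_nonempty (v : Finset Ω → ℝ) (p : Ω → ℝ) : ∃ S, S ∈ demand v p := by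
  obtain ⟨S, hS⟩ := exists_utility_eq_indirectUtility v p
  exact ⟨S, (mem_demand_iff v p S).2 hS⟩

theorem IsValuation.indirectUtility_nonneg {v : Finset Ω → ℝ} (hv : IsValuation v)
    (p : Ω → ℝ) : 0 ≤ indirectUtility v p := by
  simpa [utility, hv.empty] using utility_le_indirectUtility v p ∅

theorem continuous_indirectUtility (v : Finset Ω → ℝ) : Continuous (indirectUtility v) := by
  unfold indirectUtility utility
  refine Continuous.finset_sup'_apply _ fun S _ => ?_
  fun_prop

/-- The objective of the dual linear program, with the best dual variables of the bidders. -/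
noncomputable def dualObjective [Fintype B] (v : B → Finset Ω → ℝ) (p : Ω → ℝ) : ℝ :=
  ∑ b, indirectUtility (v b) p + ∑ j, p j

theorem continuous_dualObjective [Fintype B] (v : B → Finset Ω → ℝ) :
    Continuous (dualObjective v) := by
  unfold dualObjective
  have := fun b => continuous_indirectUtility (v b)
  fun_prop

variable [DecidableEq Ω]

theorem sum_mul_load [Fintype B] (x : B → Finset Ω → ℝ) (w : Ω → ℝ) :
    ∑ j, w j * ∑ b, ∑ S : Finset Ω with j ∈ S, x b S = ∑ b, ∑ S, x b S * ∑ j ∈ S, w j := by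
  simp_rw [Finset.sum_filter, Finset.mul_sum]
  rw [Finset.sum_comm]
  refine Finset.sum_congr rfl fun b _ => ?_
  rw [Finset.sum_comm]
  refine Finset.sum_congr rfl fun S _ => ?_
  rw [← Finset.sum_subset (Finset.subset_univ S)]
  · exact Finset.sum_congr rfl fun j hj => by rw [if_pos hj, mul_comm]
  · intro j _ hj
    rw [if_neg hj, mul_zero]

theorem reserveLPObjective_le_dualObjective [Fintype B] {v : B → Finset Ω → ℝ}
    (hv : ∀ b, IsValuation (v b)) {r p : Ω → ℝ} (hp : r ≤ p) {x : B → Finset Ω → ℝ}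
    (hx : LPFeasible x) : reserveLPObjective v r x ≤ dualObjective v p := by
  -- Lagrangian form: moving from prices `r` to `p` charges `p j - r j` for each unit of item `j`
  -- handed out.
  have split : ∑ b, ∑ S, x b S * (v b S - ∑ j ∈ S, r j) =
      ∑ b, ∑ S, x b S * utility (v b) p S
        + ∑ j, (p j - r j) * ∑ b, ∑ S : Finset Ω with j ∈ S, x b S := by
    rw [sum_mul_load, ← Finset.sum_add_distrib]
    refine Finset.sum_congr rfl fun b _ => ?_
    rw [← Finset.sum_add_distrib]
    refine Finset.sum_congr rfl fun S _ => ?_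
    rw [utility, Finset.sum_sub_distrib]
    ring
  have hb : ∑ b, ∑ S, x b S * utility (v b) p S ≤ ∑ b, indirectUtility (v b) p := by
    refine Finset.sum_le_sum fun b _ => ?_
    calc ∑ S, x b S * utility (v b) p S ≤ ∑ S, x b S * indirectUtility (v b) p :=
          Finset.sum_le_sum fun S _ =>
            mul_le_mul_of_nonneg_left (utility_le_indirectUtility _ _ _) (hx.nonneg b S)
      _ = (∑ S, x b S) * indirectUtility (v b) p := by rw [Finset.sum_mul]
      _ ≤ 1 * indirectUtility (v b) p :=
          mul_le_mul_of_nonneg_right (hx.bidder b) ((hv b).indirectUtility_nonneg p)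
      _ = indirectUtility (v b) p := one_mul _
  have hj : ∑ j, (p j - r j) * ∑ b, ∑ S : Finset Ω with j ∈ S, x b S ≤ ∑ j, (p j - r j) := by
    refine Finset.sum_le_sum fun j _ => ?_
    exact mul_le_of_le_one_right (sub_nonneg.2 (hp j)) (hx.item j)
  rw [Finset.sum_sub_distrib] at hj
  rw [reserveLPObjective, dualObjective, split]
  linarith

theorem Allocation.sum_toLP_mul (A : Allocation B Ω) (b : B) (g : Finset Ω → ℝ) :
    ∑ S, A.toLP b S * g S = g (A.bundle b) := by
  simp [Allocation.toLP]

omit [Fintype Ω] in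
theorem Allocation.sum_bundle [Fintype B] (A : Allocation B Ω) (w : Ω → ℝ) :
    ∑ b, ∑ j ∈ A.bundle b, w j = ∑ j ∈ Finset.univ.biUnion A.bundle, w j :=
  (Finset.sum_biUnion fun b _ b' _ h => A.disjoint b b' h).symm

omit [Fintype Ω] in
theorem Allocation.mem_biUnion_bundle [Fintype B] (A : Allocation B Ω) (j : Ω) :
    j ∈ Finset.univ.biUnion A.bundle ↔ A.IsAllocated j := by
  simp [Allocation.IsAllocated]

theorem Allocation.lpFeasible_toLP [Fintype B] (A : Allocation B Ω) : LPFeasible A.toLP where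
  item j := by
    have h : ∀ b, ∑ S : Finset Ω with j ∈ S, A.toLP b S = if j ∈ A.bundle b then 1 else 0 := by
      intro b
      have := A.sum_toLP_mul b fun S => if j ∈ S then 1 else 0
      simpa [Finset.sum_filter] using this
    simp_rw [h]
    rw [Finset.sum_boole]
    norm_cast
    refine Finset.card_le_one.2 fun b hb b' hb' => ?_
    by_contra hne
    exact Finset.disjoint_left.1 (A.disjoint b b' hne) (Finset.mem_filter.1 hb).2
      (Finset.mem_filter.1 hb').2
  bidder b := by simp [Allocation.toLP]
  nonneg b S := by unfold Allocation.toLP; split <;> norm_num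

/-- Complementary slackness as an identity: for `p ≥ r` every summand is nonnegative, and all of
them vanish exactly when `A` and `p` form an r-WE. -/
theorem Allocation.dualObjective_sub_reserveLPObjective [Fintype B] (v : B → Finset Ω → ℝ)
    (r p : Ω → ℝ) (A : Allocation B Ω) :
    dualObjective v p - reserveLPObjective v r A.toLP =
      ∑ b, (indirectUtility (v b) p - utility (v b) p (A.bundle b))
        + ∑ j ∈ Finset.univ \ Finset.univ.biUnion A.bundle, (p j - r j) := by
  have h1 := Finset.sum_sdiff (f := fun j => p j - r j)
    (Finset.subset_univ (Finset.univ.biUnion A.bundle))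
  rw [← A.sum_bundle] at h1
  simp only [dualObjective, reserveLPObjective, A.sum_toLP_mul, utility, Finset.sum_sub_distrib]
    at h1 ⊢
  linarith

theorem IsReserveWE.dualObjective_eq [Fintype B] {v : B → Finset Ω → ℝ} {r p : Ω → ℝ}
    {A : Allocation B Ω} (h : IsReserveWE v r A p) :
    dualObjective v p = reserveLPObjective v r A.toLP := by
  rw [← sub_eq_zero, A.dualObjective_sub_reserveLPObjective]
  rw [Finset.sum_eq_zero, Finset.sum_eq_zero, add_zero]
  · intro j hj
    rw [Finset.mem_sdiff, A.mem_biUnion_bundle] at hj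
    rw [h.unallocated j hj.2, sub_self]
  · intro b _
    rw [(mem_demand_iff _ _ _).1 (h.envyFree b), sub_self]

theorem isReserveWE_of_dualObjective_le [Fintype B] {v : B → Finset Ω → ℝ} {r p : Ω → ℝ}
    {A : Allocation B Ω} (hp : r ≤ p)
    (h : dualObjective v p ≤ reserveLPObjective v r A.toLP) : IsReserveWE v r A p := by
  have key := A.dualObjective_sub_reserveLPObjective v r p
  have h1 : ∀ b ∈ Finset.univ, 0 ≤ indirectUtility (v b) p - utility (v b) p (A.bundle b) :=
    fun b _ => sub_nonneg.2 (utility_le_indirectUtility _ _ _)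
  have h2 : ∀ j ∈ Finset.univ \ Finset.univ.biUnion A.bundle, 0 ≤ p j - r j :=
    fun j _ => sub_nonneg.2 (hp j)
  have s1 := Finset.sum_nonneg h1
  have s2 := Finset.sum_nonneg h2
  refine ⟨fun b => ?_, hp, fun j hj => ?_⟩
  · rw [mem_demand_iff]
    have := (Finset.sum_eq_zero_iff_of_nonneg h1).1 (by linarith) b (Finset.mem_univ b)
    linarith
  · have := (Finset.sum_eq_zero_iff_of_nonneg h2).1 (by linarith) j
      (by rw [Finset.mem_sdiff, A.mem_biUnion_bundle]; exact ⟨Finset.mem_univ j, hj⟩)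
    linarith

theorem IsReserveWE.isReserveLPOptimal [Fintype B] {v : B → Finset Ω → ℝ}
    (hv : ∀ b, IsValuation (v b)) {r p : Ω → ℝ} {A : Allocation B Ω}
    (h : IsReserveWE v r A p) : IsReserveLPOptimal v r A.toLP :=
  ⟨A.lpFeasible_toLP, fun _ hy =>
    h.dualObjective_eq ▸ reserveLPObjective_le_dualObjective hv h.reserve_le hy⟩

end General

/-! ### Strong duality by a separating hyperplane -/

section Duality

theorem le_of_forall_pos_add_mul_lt {K Q M : ℝ} (h : ∀ δ : ℝ, 0 < δ → K + δ * Q < M) :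
    K ≤ M := by
  have ht : Filter.Tendsto (fun δ : ℝ => K + δ * Q) (nhdsWithin 0 (Set.Ioi 0)) (nhds K) := by
    have : Continuous fun δ : ℝ => K + δ * Q := by fun_prop
    simpa using (this.tendsto 0).mono_left nhdsWithin_le_nhds
  exact le_of_tendsto ht (Filter.eventually_of_mem self_mem_nhdsWithin fun δ hδ => (h δ hδ).le)

theorem nonpos_of_forall_pos_mul_lt {c M : ℝ} (h : ∀ s : ℝ, 0 < s → s * c < M) : c ≤ 0 := by
  by_contra! hc
  have := h ((|M| + 1) / c) (by positivity)
  rw [div_mul_cancel₀ _ hc.ne'] at this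
  linarith [le_abs_self M]

variable {B Ω : Type*} [Fintype B] [Fintype Ω] [DecidableEq Ω]

/-- The bidder part of the feasibility constraints of the linear program. -/
structure BidderFeasible (x : B → Finset Ω → ℝ) : Prop where
  bidder : ∀ b : B, ∑ S : Finset Ω, x b S ≤ 1
  nonneg : ∀ (b : B) (S : Finset Ω), 0 ≤ x b S

omit [Fintype B] [DecidableEq Ω] in
theorem bidderFeasible_zero : BidderFeasible (0 : B → Finset Ω → ℝ) :=
  ⟨by simp, by simp⟩

/-- The fraction of item `j` that `x` hands out. -/
def load (x : B → Finset Ω → ℝ) (j : Ω) : ℝ := ∑ b : B, ∑ S : Finset Ω with j ∈ S, x b S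

/-- The surplus of `x` over the reserve prices. -/
def surplus (v : B → Finset Ω → ℝ) (r : Ω → ℝ) (x : B → Finset Ω → ℝ) : ℝ :=
  ∑ b : B, ∑ S : Finset Ω, x b S * (v b S - ∑ j ∈ S, r j)

theorem load_combination (a c : ℝ) (x y : B → Finset Ω → ℝ) (j : Ω) :
    load (a • x + c • y) j = a * load x j + c * load y j := by
  simp [load, Finset.sum_add_distrib, Finset.mul_sum]

omit [DecidableEq Ω] in
theorem surplus_combination (v : B → Finset Ω → ℝ) (r : Ω → ℝ) (a c : ℝ)
    (x y : B → Finset Ω → ℝ) :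
    surplus v r (a • x + c • y) = a * surplus v r x + c * surplus v r y := by
  simp only [surplus, Finset.mul_sum, ← Finset.sum_add_distrib, Pi.add_apply, Pi.smul_apply,
    smul_eq_mul]
  exact Finset.sum_congr rfl fun b _ => Finset.sum_congr rfl fun S _ => by ring

/-- The pairs of an item excess and a surplus that are strictly dominated by some `x`. -/
def strictHypograph (v : B → Finset Ω → ℝ) (r : Ω → ℝ) : Set ((Ω → ℝ) × ℝ) :=
  {q | ∃ x, BidderFeasible x ∧ (∀ j, load x j - 1 < q.1 j) ∧ q.2 < surplus v r x}

theorem isOpen_strictHypograph (v : B → Finset Ω → ℝ) (r : Ω → ℝ) :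
    IsOpen (strictHypograph v r) := by
  have : strictHypograph v r = ⋃ x ∈ {x : B → Finset Ω → ℝ | BidderFeasible x},
      (⋂ j, {q : (Ω → ℝ) × ℝ | load x j - 1 < q.1 j}) ∩ {q | q.2 < surplus v r x} := by
    ext q
    simp only [strictHypograph, Set.mem_ofPred_eq, Set.mem_iUnion, Set.mem_inter_iff,
      Set.mem_iInter, exists_prop]
  rw [this]
  refine isOpen_biUnion fun x _ => IsOpen.inter (isOpen_iInter_of_finite fun j => ?_) ?_
  · exact isOpen_lt continuous_const (by fun_prop)
  · exact isOpen_lt (by fun_prop) continuous_const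

theorem convex_strictHypograph (v : B → Finset Ω → ℝ) (r : Ω → ℝ) :
    Convex ℝ (strictHypograph v r) := by
  refine convex_iff_forall_pos.2 ?_
  rintro q ⟨x, hx, hx1, hx2⟩ q' ⟨y, hy, hy1, hy2⟩ a c ha hc hac
  refine ⟨a • x + c • y, ⟨fun b => ?_, fun b S => ?_⟩, fun j => ?_, ?_⟩
  · simp only [Pi.add_apply, Pi.smul_apply, smul_eq_mul, Finset.sum_add_distrib,
      ← Finset.mul_sum]
    nlinarith [hx.bidder b, hy.bidder b]
  · simp only [Pi.add_apply, Pi.smul_apply, smul_eq_mul]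
    have := hx.nonneg b S
    have := hy.nonneg b S
    positivity
  · rw [load_combination]
    simp only [Prod.fst_add, Prod.smul_fst, Pi.add_apply, Pi.smul_apply, smul_eq_mul]
    nlinarith [mul_lt_mul_of_pos_left (hx1 j) ha, mul_lt_mul_of_pos_left (hy1 j) hc]
  · rw [surplus_combination]
    simp only [Prod.snd_add, Prod.smul_snd, smul_eq_mul]
    nlinarith [mul_lt_mul_of_pos_left hx2 ha, mul_lt_mul_of_pos_left hy2 hc]

/-- Lagrange multipliers for the item constraints of the reserve-price linear program. -/
theorem exists_multipliers (v : B → Finset Ω → ℝ) (r : Ω → ℝ) {opt : ℝ}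
    (hopt : ∀ x, LPFeasible x → surplus v r x ≤ opt) :
    ∃ w : Ω → ℝ, 0 ≤ w ∧ ∀ x, BidderFeasible x →
      surplus v r x + ∑ j, w j * (1 - load x j) ≤ opt := by
  -- A bidder-feasible point with item excess below `0` is LP feasible, so its surplus cannot exceed
  -- `opt`.
  have hnot : ((0 : Ω → ℝ), opt) ∉ strictHypograph v r := by
    rintro ⟨x, hx, h1, h2⟩
    exact (hopt x ⟨fun j => (sub_neg.1 (h1 j)).le, hx.bidder, hx.nonneg⟩).not_gt h2
  obtain ⟨f, hf⟩ := geometric_hahn_banach_open_point (convex_strictHypograph v r)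
    (isOpen_strictHypograph v r) hnot
  set μ : ℝ := f (0, 1) with hμ
  set c : Ω → ℝ := fun j => f (Pi.single j 1, 0) with hc
  have hfz : ∀ z t, f (z, t) = ∑ j, z j * c j + t * μ := by
    intro z t
    have h0 : (z, t) = ∑ j, z j • ((Pi.single j 1 : Ω → ℝ), (0 : ℝ)) + t • ((0 : Ω → ℝ), (1 : ℝ)) := by
      ext k
      · simp [Prod.fst_sum, Finset.sum_apply, Pi.single_apply]
      · simp [Prod.snd_sum]
    rw [h0, map_add, map_sum, map_smul]
    simp only [map_smul, smul_eq_mul, hμ, hc]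
  have hf' : ∀ x, BidderFeasible x → ∀ z : Ω → ℝ, (∀ j, load x j - 1 < z j) →
      ∀ t < surplus v r x, ∑ j, z j * c j + t * μ < opt * μ := by
    intro x hx z hz t ht
    have := hf (z, t) ⟨x, hx, hz, ht⟩
    rw [hfz, hfz] at this
    simpa using this
  have l0 : ∀ j, load (0 : B → Finset Ω → ℝ) j = 0 := by simp [load]
  have s0 : surplus v r 0 = 0 := by simp [surplus]
  have hopt0 : 0 ≤ opt := by
    have := hopt 0 ⟨by simp, by simp, by simp⟩
    rwa [s0] at this
  -- Slater's condition: `x = 0` leaves every item constraint slack, so the hyperplane is not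
  -- vertical.
  have hμpos : 0 < μ := by
    have := hf' 0 bidderFeasible_zero 0 (by simp [l0]) (-1) (by simp [s0])
    simp only [Pi.zero_apply, zero_mul, Finset.sum_const_zero, zero_add] at this
    nlinarith
  have hcneg : ∀ j, c j ≤ 0 := by
    intro j
    refine nonpos_of_forall_pos_mul_lt (M := opt * μ + μ) fun s hs => ?_
    have := hf' 0 bidderFeasible_zero (Pi.single j s) (fun k => by
      have : 0 ≤ (Pi.single j s : Ω → ℝ) k := by
        rcases eq_or_ne k j with rfl | h
        · simpa using hs.le
        · simp [h]
      rw [l0]; linarith) (-1) (by simp [s0])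
    rw [Finset.sum_eq_single j (fun k _ hk => by simp [hk]) (by simp)] at this
    simp only [Pi.single_eq_same] at this
    linarith
  refine ⟨fun j => -c j / μ, fun j => div_nonneg (neg_nonneg.2 (hcneg j)) hμpos.le,
    fun x hx => ?_⟩
  -- The point given by `x` itself lies only on the boundary; it is approached from inside by shifts
  -- of size `δ`.
  have hle : ∑ j, (load x j - 1) * c j + surplus v r x * μ ≤ opt * μ := by
    refine le_of_forall_pos_add_mul_lt (Q := ∑ j, c j - μ) fun δ hδ => ?_
    have := hf' x hx (fun j => load x j - 1 + δ) (fun j => by linarith)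
      (surplus v r x - δ) (by linarith)
    simp only [add_mul _ δ, Finset.sum_add_distrib, ← Finset.mul_sum] at this
    linarith
  have heq : ∑ j, -c j / μ * (1 - load x j) = (∑ j, (load x j - 1) * c j) / μ := by
    rw [Finset.sum_div]
    exact Finset.sum_congr rfl fun j _ => by ring
  rw [heq]
  have : (∑ j, (load x j - 1) * c j) / μ ≤ opt - surplus v r x := by
    rw [div_le_iff₀ hμpos]
    linarith
  linarith

theorem IsReserveLPOptimal.exists_isReserveWE {v : B → Finset Ω → ℝ} {r : Ω → ℝ}
    {A : Allocation B Ω} (h : IsReserveLPOptimal v r A.toLP) :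
    ∃ p, IsReserveWE v r A p := by
  obtain ⟨w, hw, hle⟩ := exists_multipliers v r (opt := surplus v r A.toLP) fun x hx => by
    have := h.2 x hx
    simp only [reserveLPObjective] at this
    simp only [surplus]
    linarith
  refine ⟨r + w, isReserveWE_of_dualObjective_le (le_add_of_nonneg_right hw) ?_⟩
  choose T hT using fun b => exists_utility_eq_indirectUtility (v b) (r + w)
  have hpick : ∀ b (g : Finset Ω → ℝ), ∑ S, (if S = T b then 1 else 0) * g S = g (T b) := by
    simp
  -- Each bidder picks a favourite bundle at `r + w`. These bundles may overlap, since the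
  -- Lagrangian bound needs only the bidder constraints.
  have := hle (fun b S => if S = T b then 1 else 0)
    ⟨fun b => by simp, fun b S => by split <;> norm_num⟩
  simp only [mul_sub, mul_one, Finset.sum_sub_distrib] at this
  simp only [load, sum_mul_load] at this
  simp only [surplus, hpick] at this
  rw [dualObjective, reserveLPObjective]
  simp_rw [← hT]
  simp only [utility, Pi.add_apply, Finset.sum_add_distrib, Finset.sum_sub_distrib] at this ⊢
  linarith

end Duality

/-! ### The additive bidder who holds the reserve prices -/

section Extension

variable {B Ω : Type*} [Fintype B] [Fintype Ω] [DecidableEq Ω]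

theorem Allocation.extend_isAllocated (A : Allocation B Ω) (j : Ω) : A.extend.IsAllocated j := by
  by_cases h : A.IsAllocated j
  · obtain ⟨b, hb⟩ := h
    exact ⟨some b, hb⟩
  · refine ⟨none, ?_⟩
    change j ∈ Finset.univ \ Finset.univ.biUnion A.bundle
    rw [Finset.mem_sdiff, A.mem_biUnion_bundle]
    exact ⟨Finset.mem_univ j, h⟩

omit [Fintype Ω] [DecidableEq Ω] in
theorem utility_sum (r p : Ω → ℝ) (S : Finset Ω) :
    utility (fun S => ∑ j ∈ S, r j) p S = ∑ j ∈ S, (r j - p j) := by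
  rw [utility, Finset.sum_sub_distrib]

theorem IsReserveWE.extend {v : B → Finset Ω → ℝ} {r p : Ω → ℝ} (hr : 0 ≤ r)
    {A : Allocation B Ω} (h : IsReserveWE v r A p) :
    IsWE (extendValuations v r) A.extend p where
  envyFree := by
    rintro (_ | b)
    · intro T
      change utility (fun S => ∑ j ∈ S, r j) p T ≤
        utility (fun S => ∑ j ∈ S, r j) p (Finset.univ \ Finset.univ.biUnion A.bundle)
      rw [utility_sum, utility_sum, Finset.sum_eq_zero (s := Finset.univ \ _)]
      · exact Finset.sum_nonpos fun j _ => sub_nonpos.2 (h.reserve_le j)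
      · intro j hj
        rw [Finset.mem_sdiff, A.mem_biUnion_bundle] at hj
        rw [h.unallocated j hj.2, sub_self]
    · exact h.envyFree b
  nonneg := hr.trans h.reserve_le
  unallocated j hj := absurd (A.extend_isAllocated j) hj

theorem IsWE.isReserveWE {v : B → Finset Ω → ℝ} {r p p' : Ω → ℝ} {A : Allocation B Ω}
    (h : IsWE (extendValuations v r) A.extend p') (hp : ∀ j, A.IsAllocated j → p j = p' j)
    (hr : ∀ j, ¬ A.IsAllocated j → p j = r j) : IsReserveWE v r A p := by
  have hnone : ∀ T, ∑ j ∈ T, (r j - p' j) ≤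
      ∑ j ∈ Finset.univ \ Finset.univ.biUnion A.bundle, (r j - p' j) := by
    intro T
    have := h.envyFree none T
    change utility (fun S => ∑ j ∈ S, r j) p' T ≤
        utility (fun S => ∑ j ∈ S, r j) p' (Finset.univ \ Finset.univ.biUnion A.bundle) at this
    rwa [utility_sum, utility_sum] at this
  have hmem : ∀ j, j ∈ Finset.univ \ Finset.univ.biUnion A.bundle ↔ ¬ A.IsAllocated j := by
    intro j
    rw [Finset.mem_sdiff, A.mem_biUnion_bundle]
    simp
  -- The additive bidder gains neither by adding an allocated item nor, below, by dropping an
  -- unallocated one.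
  have halloc : ∀ j, A.IsAllocated j → r j ≤ p' j := by
    intro j hj
    have := hnone (insert j (Finset.univ \ Finset.univ.biUnion A.bundle))
    rw [Finset.sum_insert (by rw [hmem]; simpa using hj)] at this
    linarith
  have hunalloc : ∀ j, ¬ A.IsAllocated j → p' j ≤ r j := by
    intro j hj
    have := hnone ((Finset.univ \ Finset.univ.biUnion A.bundle).erase j)
    rw [← Finset.add_sum_erase _ _ ((hmem j).2 hj)] at this
    linarith
  have hle : p' ≤ p := by
    intro j
    by_cases hj : A.IsAllocated j
    · exact (hp j hj).ge
    · exact (hunalloc j hj).trans (hr j hj).ge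
  refine ⟨fun b T => ?_, fun j => ?_, hr⟩
  · have h1 : utility (v b) p' T ≤ utility (v b) p' (A.bundle b) := h.envyFree (some b) T
    have h2 : ∑ j ∈ T, p' j ≤ ∑ j ∈ T, p j := Finset.sum_le_sum fun j _ => hle j
    have h3 : ∑ j ∈ A.bundle b, p j = ∑ j ∈ A.bundle b, p' j :=
      Finset.sum_congr rfl fun j hj => hp j ⟨b, hj⟩
    unfold utility at *
    linarith
  · by_cases hj : A.IsAllocated j
    · exact (halloc j hj).trans (hp j hj).ge
    · exact (hr j hj).ge

end Extension

/-! ### Existence by an ascending auction -/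

section Auction

variable {B Ω : Type*} [Fintype Ω] [DecidableEq Ω]

/-- The prices that a bidder with the bundle `S` faces: `ε` more for all other items. -/
def bidPrices (ε : ℝ) (p : Ω → ℝ) (S : Finset Ω) (j : Ω) : ℝ := if j ∈ S then p j else p j + ε

/-- The prices after each item `j` has been raised `k j` times. -/
def raisedPrices (r : Ω → ℝ) (ε : ℝ) (k : Ω → ℕ) (j : Ω) : ℝ := r j + ε * k j

/-- The invariant of the ascending auction. -/
structure IsAuctionState (v : B → Finset Ω → ℝ) (r : Ω → ℝ) (ε : ℝ) (A : Allocation B Ω)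
    (k : Ω → ℕ) : Prop where
  exists_demand : ∀ b, ∃ D ∈ demand (v b) (bidPrices ε (raisedPrices r ε k) (A.bundle b)),
    A.bundle b ⊆ D
  unallocated : ∀ j, ¬ A.IsAllocated j → k j = 0

theorem IsValuation.price_le_of_mem_demand {v : Finset Ω → ℝ} (hv : IsValuation v) {p : Ω → ℝ}
    {D : Finset Ω} (hD : D ∈ demand v p) {j : Ω} (hj : j ∈ D) : p j ≤ v Finset.univ := by
  have h := hD (D.erase j)
  rw [utility, utility, ← Finset.add_sum_erase _ _ hj] at h
  have h1 := hv.mono D Finset.univ (Finset.subset_univ D)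
  have h2 := hv.mono ∅ (D.erase j) (Finset.empty_subset _)
  rw [hv.empty] at h2
  linarith

/-- Only held items have been raised, and a holder's demanded set contains the item at its current
price, which therefore is at most the value of all items to that holder. -/
theorem IsAuctionState.sum_le [Fintype B] {v : B → Finset Ω → ℝ} (hv : ∀ b, IsValuation (v b))
    {r : Ω → ℝ} (hr : 0 ≤ r) {ε : ℝ} (hε : 0 < ε) {A : Allocation B Ω} {k : Ω → ℕ}
    (h : IsAuctionState v r ε A k) :
    ∑ j, k j ≤ ∑ _j : Ω, ⌈(∑ b, v b Finset.univ) / ε⌉₊ := by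
  have hnn : ∀ b, 0 ≤ v b Finset.univ := fun b =>
    (hv b).empty ▸ (hv b).mono ∅ Finset.univ (Finset.empty_subset _)
  refine Finset.sum_le_sum fun j _ => ?_
  by_cases hj : A.IsAllocated j
  · obtain ⟨b, hb⟩ := hj
    obtain ⟨D, hD, hsub⟩ := h.exists_demand b
    have h1 := (hv b).price_le_of_mem_demand hD (hsub hb)
    rw [bidPrices, if_pos hb, raisedPrices] at h1
    have h2 := Finset.single_le_sum (f := fun b => v b Finset.univ) (fun b _ => hnn b)
      (Finset.mem_univ b)
    have h3 : (k j : ℝ) ≤ (∑ b, v b Finset.univ) / ε := by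
      rw [le_div_iff₀ hε]
      have : 0 ≤ r j := hr j
      linarith
    exact_mod_cast h3.trans (Nat.le_ceil _)
  · rw [h.unallocated j hj]
    exact Nat.zero_le _

open Classical in
/-- The bidder `b` takes the bundle `D`. -/
noncomputable def Allocation.take (A : Allocation B Ω) (b : B) (D : Finset Ω) :
    Allocation B Ω where
  bundle b' := if b' = b then D else A.bundle b' \ D
  disjoint b₁ b₂ hne := by
    by_cases h1 : b₁ = b <;> by_cases h2 : b₂ = b
    · exact absurd (h1.trans h2.symm) hne
    · simpa [h1, h2] using Finset.disjoint_sdiff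
    · simpa [h1, h2] using Finset.sdiff_disjoint
    · simpa [h1, h2] using (A.disjoint b₁ b₂ hne).mono Finset.sdiff_subset Finset.sdiff_subset

omit [Fintype Ω] in
theorem Allocation.take_same (A : Allocation B Ω) (b : B) (D : Finset Ω) :
    (A.take b D).bundle b = D := by simp [Allocation.take]

omit [Fintype Ω] in
theorem Allocation.take_of_ne (A : Allocation B Ω) {b b' : B} (h : b' ≠ b) (D : Finset Ω) :
    (A.take b D).bundle b' = A.bundle b' \ D := by simp [Allocation.take, h]

-- The prices that `b` faces do not change: the `ε` surcharge on newly taken items becomes part of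
-- their price. Other bidders face weakly higher prices, unchanged on the items they keep, so by
-- gross substitutes those items stay inside a demanded set. As `b` gives nothing up, an allocated
-- item stays allocated.
omit [Fintype Ω] in
theorem IsAuctionState.step {v : B → Finset Ω → ℝ} (hgs : ∀ b, GrossSubstitute (v b))
    {r : Ω → ℝ} (hr : 0 ≤ r) {ε : ℝ} (hε : 0 < ε) {A : Allocation B Ω} {k : Ω → ℕ}
    (h : IsAuctionState v r ε A k) {b : B} {D : Finset Ω}
    (hD : D ∈ demand (v b) (bidPrices ε (raisedPrices r ε k) (A.bundle b)))
    (hsub : A.bundle b ⊆ D) :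
    IsAuctionState v r ε (A.take b D) (fun j => if j ∈ D \ A.bundle b then k j + 1 else k j) where
  exists_demand b' := by
    by_cases hb : b' = b
    · subst hb
      refine ⟨D, ?_, (A.take_same b' D).le⟩
      rw [A.take_same]
      convert hD using 2
      funext j
      by_cases h1 : j ∈ D <;> by_cases h2 : j ∈ A.bundle b'
      · simp [bidPrices, raisedPrices, h1, h2]
      · simp [bidPrices, raisedPrices, h1, h2]; ring
      · exact absurd (hsub h2) h1
      · simp [bidPrices, raisedPrices, h1, h2]
    · obtain ⟨D₁, hD₁, hsub₁⟩ := h.exists_demand b'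
      rw [A.take_of_ne hb]
      set k' : Ω → ℕ := fun j => if j ∈ D \ A.bundle b then k j + 1 else k j with hk'
      have hnonneg : 0 ≤ bidPrices ε (raisedPrices r ε k) (A.bundle b') := by
        intro j
        have h1 : 0 ≤ r j := hr j
        have h2 : 0 ≤ ε * (k j : ℝ) := by positivity
        simp only [bidPrices, raisedPrices, Pi.zero_apply]
        split <;> linarith
      have hle : bidPrices ε (raisedPrices r ε k) (A.bundle b') ≤
          bidPrices ε (raisedPrices r ε k') (A.bundle b' \ D) := by
        intro j
        have h0 : (k j : ℝ) ≤ k' j := by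
          rw [hk']
          dsimp only
          split <;> simp
        have h1 := mul_le_mul_of_nonneg_left h0 hε.le
        simp only [bidPrices, raisedPrices]
        by_cases h2 : j ∈ A.bundle b' \ D
        · rw [if_pos (Finset.mem_sdiff.1 h2).1, if_pos h2]
          linarith
        · rw [if_neg h2]
          split <;> linarith
      obtain ⟨D₂, hD₂, hsub₂⟩ := hgs b' _ _ hnonneg hle D₁ hD₁
      refine ⟨D₂, hD₂, fun j hj => hsub₂ j (hsub₁ (Finset.mem_sdiff.1 hj).1) ?_⟩
      have h1 := Finset.mem_sdiff.1 hj
      simp [bidPrices, raisedPrices, hk', h1]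
  unallocated j hj := by
    have hjD : j ∉ D := fun hjD => hj ⟨b, by rwa [A.take_same]⟩
    have hjA : ¬ A.IsAllocated j := by
      rintro ⟨b', hb'⟩
      by_cases hb : b' = b
      · exact hjD (hsub (hb ▸ hb'))
      · exact hj ⟨b', by rw [A.take_of_ne hb]; exact Finset.mem_sdiff.2 ⟨hb', hjD⟩⟩
    simp [hjD, h.unallocated j hjA]

/-- The ascending auction ends with an approximate equilibrium. -/
theorem exists_approximate_equilibrium [Fintype B] {v : B → Finset Ω → ℝ}
    (hv : ∀ b, IsValuation (v b)) (hgs : ∀ b, GrossSubstitute (v b)) {r : Ω → ℝ} (hr : 0 ≤ r)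
    {ε : ℝ} (hε : 0 < ε) :
    ∃ (A : Allocation B Ω) (p : Ω → ℝ), r ≤ p ∧ (∀ j, ¬ A.IsAllocated j → p j = r j) ∧
      ∀ b, A.bundle b ∈ demand (v b) (bidPrices ε p (A.bundle b)) := by
  let N := ∑ _j : Ω, ⌈(∑ b, v b Finset.univ) / ε⌉₊
  -- Instead of running the auction, take a state with the largest total number of raises: a further
  -- step that takes a new item would increase it.
  let good : Set ℕ := {n | ∃ (A : Allocation B Ω) (k : Ω → ℕ),
    IsAuctionState v r ε A k ∧ ∑ j, k j = n}
  have hne : good.Nonempty := by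
    refine ⟨0, ⟨fun _ => ∅, fun _ _ _ => Finset.disjoint_empty_left _⟩, 0, ⟨fun b => ?_, ?_⟩, ?_⟩
    · obtain ⟨D, hD⟩ := demand_nonempty (v b) (bidPrices ε (raisedPrices r ε 0) ∅)
      exact ⟨D, hD, Finset.empty_subset D⟩
    · intro j _
      rfl
    · simp
  have hbdd : BddAbove good := by
    refine ⟨N, ?_⟩
    rintro n ⟨A, k, hA, rfl⟩
    exact hA.sum_le hv hr hε
  obtain ⟨A, k, hA, hk⟩ := Nat.sSup_mem hne hbdd
  refine ⟨A, raisedPrices r ε k, fun j => ?_, fun j hj => ?_, fun b => ?_⟩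
  · exact le_add_of_nonneg_right (by positivity)
  · simp [raisedPrices, hA.unallocated j hj]
  · obtain ⟨D, hD, hsub⟩ := hA.exists_demand b
    suffices A.bundle b = D by rwa [← this] at hD
    refine hsub.antisymm fun j hj => ?_
    by_contra hjA
    have hle := le_csSup hbdd ⟨_, _, hA.step hgs hr hε hD hsub, rfl⟩
    rw [← hk] at hle
    refine hle.not_gt (Finset.sum_lt_sum (fun i _ => ?_) ⟨j, Finset.mem_univ j, ?_⟩)
    · split <;> omega
    · rw [if_pos (Finset.mem_sdiff.2 ⟨hj, hjA⟩)]
      exact Nat.lt_succ_self _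

theorem dualObjective_le_of_approximate_equilibrium [Fintype B] {v : B → Finset Ω → ℝ}
    {r p : Ω → ℝ} {ε : ℝ} (hε : 0 ≤ ε) {A : Allocation B Ω}
    (hun : ∀ j, ¬ A.IsAllocated j → p j = r j)
    (hA : ∀ b, A.bundle b ∈ demand (v b) (bidPrices ε p (A.bundle b))) :
    dualObjective v p ≤
      reserveLPObjective v r A.toLP + Fintype.card B * (Fintype.card Ω * ε) := by
  have key := A.dualObjective_sub_reserveLPObjective v r p
  rw [Finset.sum_eq_zero (s := Finset.univ \ _) (fun j hj => by
    rw [Finset.mem_sdiff, A.mem_biUnion_bundle] at hj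
    rw [hun j hj.2, sub_self])] at key
  have hb : ∑ b, (indirectUtility (v b) p - utility (v b) p (A.bundle b)) ≤
      ∑ _b : B, Fintype.card Ω * ε := by
    refine Finset.sum_le_sum fun b _ => ?_
    obtain ⟨T, hT⟩ := exists_utility_eq_indirectUtility (v b) p
    have h := hA b T
    rw [← hT]
    unfold utility at *
    have h1 : ∑ j ∈ A.bundle b, bidPrices ε p (A.bundle b) j = ∑ j ∈ A.bundle b, p j :=
      Finset.sum_congr rfl fun j hj => by rw [bidPrices, if_pos hj]
    have h2 : ∑ j ∈ T, bidPrices ε p (A.bundle b) j ≤ ∑ j ∈ T, p j + Fintype.card Ω * ε := by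
      calc ∑ j ∈ T, bidPrices ε p (A.bundle b) j ≤ ∑ j ∈ T, (p j + ε) :=
            Finset.sum_le_sum fun j _ => by unfold bidPrices; split <;> linarith
        _ = ∑ j ∈ T, p j + T.card * ε := by
            rw [Finset.sum_add_distrib, Finset.sum_const, nsmul_eq_mul]
        _ ≤ _ := by
            have : (T.card : ℝ) ≤ Fintype.card Ω := by exact_mod_cast Finset.card_le_univ T
            gcongr
    linarith
  rw [Finset.sum_const, nsmul_eq_mul, Finset.card_univ] at hb
  linarith

omit [DecidableEq Ω] in
theorem finite_allocation [Finite B] : Finite (Allocation B Ω) :=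
  Finite.of_injective Allocation.bundle fun A A' h => by
    cases A; cases A'; simpa using h

theorem exists_isReserveWE_of_grossSubstitute [Fintype B] {v : B → Finset Ω → ℝ}
    (hv : ∀ b, IsValuation (v b)) (hgs : ∀ b, GrossSubstitute (v b)) {r : Ω → ℝ} (hr : 0 ≤ r) :
    ∃ (A : Allocation B Ω) (p : Ω → ℝ), IsReserveWE v r A p := by
  have : Finite (Allocation B Ω) := finite_allocation
  have : Nonempty (Allocation B Ω) :=
    ⟨⟨fun _ => ∅, fun _ _ _ => Finset.disjoint_empty_left _⟩⟩
  obtain ⟨A, hA⟩ := Finite.exists_max fun A : Allocation B Ω => reserveLPObjective v r A.toLP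
  refine ⟨A, IsReserveLPOptimal.exists_isReserveWE ⟨A.lpFeasible_toLP, fun y hy => ?_⟩⟩
  -- The first summand of `Q` absorbs the gap of the approximate equilibrium; the `+ 1` makes the
  -- inequality strict.
  refine le_of_forall_pos_add_mul_lt (Q := -(Fintype.card B * Fintype.card Ω + 1 : ℝ))
    fun δ hδ => ?_
  obtain ⟨A', p, hp, hun, hdem⟩ := exists_approximate_equilibrium hv hgs hr hδ
  have h1 := dualObjective_le_of_approximate_equilibrium hδ.le hun hdem
  have h2 := reserveLPObjective_le_dualObjective hv hp hy
  have h3 := hA A'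
  linarith

end Auction

/-! ### Submodularity and the lattice of equilibrium prices -/

section Lattice

variable {B Ω : Type*} [Fintype Ω] [DecidableEq Ω]

omit [Fintype Ω] in
theorem utility_update (v : Finset Ω → ℝ) (p : Ω → ℝ) (j : Ω) (t : ℝ) (S : Finset Ω) :
    utility v (Function.update p j t) S =
      utility v p S - if j ∈ S then t - p j else 0 := by
  unfold utility
  split_ifs with h
  · rw [← Finset.add_sum_erase _ _ h, ← Finset.add_sum_erase _ _ h, Function.update_self,
      Finset.sum_congr rfl fun i hi => Function.update_of_ne (Finset.ne_of_mem_erase hi) t p]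
    ring
  · rw [Finset.sum_congr rfl fun i hi =>
      Function.update_of_ne (fun e : i = j => h (e ▸ hi)) t p]
    ring

/-- As a function of one price, the indirect utility is a maximum of a constant, attained without
the item, and a function with slope `-1`, attained with the item. -/
theorem exists_indirectUtility_update (v : Finset Ω → ℝ) (p : Ω → ℝ) (j : Ω) :
    ∃ S T : Finset Ω, j ∉ S ∧ j ∈ T ∧ (∀ R, j ∈ R → utility v p R ≤ utility v p T) ∧
      ∀ t, indirectUtility v (Function.update p j t) =
      max (utility v p S) (utility v p T + p j - t) := by
  obtain ⟨S, hS, hSmax⟩ := Finset.exists_max_image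
    (Finset.univ.filter fun S : Finset Ω => j ∉ S) (utility v p) ⟨∅, by simp⟩
  obtain ⟨T, hT, hTmax⟩ := Finset.exists_max_image
    (Finset.univ.filter fun S : Finset Ω => j ∈ S) (utility v p) ⟨{j}, by simp⟩
  simp only [Finset.mem_filter, Finset.mem_univ, true_and] at hS hT hSmax hTmax
  refine ⟨S, T, hS, hT, hTmax, fun t => le_antisymm ?_ (max_le ?_ ?_)⟩
  · obtain ⟨R, hR⟩ := exists_utility_eq_indirectUtility v (Function.update p j t)
    rw [← hR, utility_update]
    by_cases h : j ∈ R
    · rw [if_pos h]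
      exact le_max_of_le_right (by linarith [hTmax R h])
    · rw [if_neg h]
      exact le_max_of_le_left (by linarith [hSmax R h])
  · have := utility_le_indirectUtility v (Function.update p j t) S
    rw [utility_update, if_neg hS] at this
    linarith
  · have := utility_le_indirectUtility v (Function.update p j t) T
    rw [utility_update, if_pos hT] at this
    linarith

/-- In the price of `j`, the indirect utility falls with slope `-1` up to a kink and is constant
afterwards. When other prices rise, gross substitutes cannot move a kink lying at or above `m j` to
the left, so raising the price of `j` costs at least as much at `n` as at `m`. -/
theorem GrossSubstitute.indirectUtility_update_sub_le {v : Finset Ω → ℝ}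
    (hgs : GrossSubstitute v) {m n : Ω → ℝ} (hm : 0 ≤ m) (hmn : m ≤ n) {j : Ω}
    (hj : m j = n j) {t : ℝ} (ht : m j ≤ t) :
    indirectUtility v (Function.update n j t) - indirectUtility v n ≤
      indirectUtility v (Function.update m j t) - indirectUtility v m := by
  obtain ⟨S, T, -, hT, -, h⟩ := exists_indirectUtility_update v m j
  obtain ⟨S', T', hS', -, hTmax', h'⟩ := exists_indirectUtility_update v n j
  have hm0 := h (m j)
  have hn0 := h' (n j)
  rw [Function.update_eq_self] at hm0 hn0
  rw [h, h', hm0, hn0, ← hj]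
  rcases lt_or_ge (utility v m T) (utility v m S) with hlt | hge
  · rw [max_eq_left (by linarith : utility v m T + m j - t ≤ utility v m S),
      max_eq_left (by linarith : utility v m T + m j - m j ≤ utility v m S)]
    have : max (utility v n S') (utility v n T' + m j - t) ≤
        max (utility v n S') (utility v n T' + m j - m j) :=
      max_le_max le_rfl (by linarith)
    linarith
  · have hdiff : utility v m T - utility v m S ≤ utility v n T' - utility v n S' := by
      -- The kink at `m`: at this price of `j`, `S` and `T` are equally good and both demanded.
      set s := m j + (utility v m T - utility v m S) with hs
      have hms : m j ≤ s := by linarith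
      have hTdem : T ∈ demand v (Function.update m j s) := by
        rw [mem_demand_iff, h, utility_update, if_pos hT, max_eq_left (by linarith)]
        linarith
      obtain ⟨D, hD, hsub⟩ := hgs (Function.update m j s) (Function.update n j s)
        (fun i => by
          rcases eq_or_ne i j with rfl | hi
          · rw [Function.update_self]; exact (hm i).trans hms
          · rw [Function.update_of_ne hi]; exact hm i)
        (update_le_update_iff.2 ⟨le_rfl, fun i _ => hmn i⟩) T hTdem
      have hjD := hsub j hT (by rw [Function.update_self, Function.update_self])
      have h1 : utility v (Function.update n j s) D ≤ utility v n T' + n j - s := by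
        rw [utility_update, if_pos hjD]
        linarith [hTmax' D hjD]
      have h2 := hD S'
      rw [utility_update, if_neg hS'] at h2
      linarith
    rcases max_cases (utility v n S') (utility v n T' + m j - t) with ⟨e1, _⟩ | ⟨e1, _⟩ <;>
    rcases max_cases (utility v n S') (utility v n T' + m j - m j) with ⟨e2, _⟩ | ⟨e2, _⟩ <;>
    rcases max_cases (utility v m S) (utility v m T + m j - t) with ⟨e3, _⟩ | ⟨e3, _⟩ <;>
    rcases max_cases (utility v m S) (utility v m T + m j - m j) with ⟨e4, _⟩ | ⟨e4, _⟩ <;>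
    rw [e1, e2, e3, e4] <;> linarith

theorem GrossSubstitute.indirectUtility_piecewise_sub_le {v : Finset Ω → ℝ}
    (hgs : GrossSubstitute v) {m n q : Ω → ℝ} (hm : 0 ≤ m) (hmn : m ≤ n) (T : Finset Ω)
    (hT : ∀ j ∈ T, m j = n j ∧ m j ≤ q j) :
    indirectUtility v (T.piecewise q n) - indirectUtility v n ≤
      indirectUtility v (T.piecewise q m) - indirectUtility v m := by
  induction T using Finset.induction_on with
  | empty => simp
  | insert j T hj ih =>
    have h1 := ih fun i hi => hT i (Finset.mem_insert_of_mem hi)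
    obtain ⟨h2, h3⟩ := hT j (Finset.mem_insert_self j T)
    rw [Finset.piecewise_insert, Finset.piecewise_insert]
    have h4 := hgs.indirectUtility_update_sub_le (m := T.piecewise q m) (n := T.piecewise q n)
      (j := j) (t := q j)
      (fun i => by
        by_cases hi : i ∈ T
        · rw [Finset.piecewise_eq_of_mem _ _ _ hi]
          exact (hm i).trans (hT i (Finset.mem_insert_of_mem hi)).2
        · rw [Finset.piecewise_eq_of_notMem _ _ _ hi]
          exact hm i)
      (fun i => by
        by_cases hi : i ∈ T
        · rw [Finset.piecewise_eq_of_mem _ _ _ hi, Finset.piecewise_eq_of_mem _ _ _ hi]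
        · rw [Finset.piecewise_eq_of_notMem _ _ _ hi, Finset.piecewise_eq_of_notMem _ _ _ hi]
          exact hmn i)
      (by rw [Finset.piecewise_eq_of_notMem _ _ _ hj, Finset.piecewise_eq_of_notMem _ _ _ hj, h2])
      (by rwa [Finset.piecewise_eq_of_notMem _ _ _ hj])
    linarith

/-- The indirect utility of a gross-substitute valuation is submodular in the prices. -/
theorem GrossSubstitute.indirectUtility_sup_add_inf_le {v : Finset Ω → ℝ}
    (hgs : GrossSubstitute v) {p q : Ω → ℝ} (hp : 0 ≤ p) (hq : 0 ≤ q) :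
    indirectUtility v (p ⊔ q) + indirectUtility v (p ⊓ q) ≤
      indirectUtility v p + indirectUtility v q := by
  -- Raising to `q` the items with `p j ≤ q j` leads from `p ⊓ q` to `q` and from `p` to `p ⊔ q`.
  have h := hgs.indirectUtility_piecewise_sub_le (m := p ⊓ q) (n := p) (q := q) (le_inf hp hq)
    inf_le_left (Finset.univ.filter fun j => p j ≤ q j) (fun j hj => by
      have : p j ≤ q j := (Finset.mem_filter.1 hj).2
      simp [this])
  have e1 : (Finset.univ.filter fun j => p j ≤ q j).piecewise q p = p ⊔ q := by
    funext j
    by_cases hj : p j ≤ q j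
    · simp [Finset.piecewise, hj]
    · simp [Finset.piecewise, hj, (not_le.1 hj).le]
  have e2 : (Finset.univ.filter fun j => p j ≤ q j).piecewise q (p ⊓ q) = q := by
    funext j
    by_cases hj : p j ≤ q j
    · simp [Finset.piecewise, hj]
    · simp [Finset.piecewise, hj, (not_le.1 hj).le]
  rw [e1, e2] at h
  linarith

theorem dualObjective_sup_add_inf_le [Fintype B] {v : B → Finset Ω → ℝ}
    (hgs : ∀ b, GrossSubstitute (v b)) {p q : Ω → ℝ} (hp : 0 ≤ p) (hq : 0 ≤ q) :
    dualObjective v (p ⊔ q) + dualObjective v (p ⊓ q) ≤ dualObjective v p + dualObjective v q := by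
  have h1 : ∑ b, indirectUtility (v b) (p ⊔ q) + ∑ b, indirectUtility (v b) (p ⊓ q) ≤
      ∑ b, indirectUtility (v b) p + ∑ b, indirectUtility (v b) q := by
    rw [← Finset.sum_add_distrib, ← Finset.sum_add_distrib]
    exact Finset.sum_le_sum fun b _ => (hgs b).indirectUtility_sup_add_inf_le hp hq
  have h2 : ∑ j, (p ⊔ q) j + ∑ j, (p ⊓ q) j = ∑ j, p j + ∑ j, q j := by
    rw [← Finset.sum_add_distrib, ← Finset.sum_add_distrib]
    exact Finset.sum_congr rfl fun j _ => max_add_min (p j) (q j)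
  unfold dualObjective
  linarith

theorem exists_isGLB_of_isClosed_of_infClosed {P X : Set (Ω → ℝ)} (hc : IsClosed P)
    (hinf : InfClosed P) (hb : BddBelow P) (hXP : X ⊆ P) (hX : X.Nonempty) :
    ∃ q ∈ P, IsGLB X q := by
  have hq : IsGLB X (sInf X) := isGLB_csInf hX (hb.mono hXP)
  refine ⟨sInf X, ?_, hq⟩
  rw [← hc.closure_eq, Metric.mem_closure_iff]
  intro ε hε
  -- Meeting with one nearly minimal element of `X` per item stays in `P`; as there are finitely
  -- many items, this approximates `sInf X` uniformly.
  have key : ∀ T : Finset Ω, ∃ p ∈ P, sInf X ≤ p ∧ ∀ j ∈ T, p j < sInf X j + ε / 2 := by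
    intro T
    induction T using Finset.induction_on with
    | empty =>
      obtain ⟨x, hx⟩ := hX
      exact ⟨x, hXP hx, hq.1 hx, by simp⟩
    | insert j T _ ih =>
      obtain ⟨p, hp, hle, hlt⟩ := ih
      obtain ⟨_, ⟨x, hx, rfl⟩, hxj⟩ : ∃ a ∈ (fun x : Ω → ℝ => x j) '' X, a < sInf X j + ε / 2 :=
        (isGLB_lt_iff (isGLB_pi.1 hq j)).1 (by linarith)
      refine ⟨p ⊓ x, hinf hp (hXP hx), le_inf hle (hq.1 hx), fun i hi => ?_⟩
      rcases Finset.mem_insert.1 hi with rfl | hi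
      · exact lt_of_le_of_lt inf_le_right hxj
      · exact lt_of_le_of_lt inf_le_left (hlt i hi)
  obtain ⟨p, hp, hle, hlt⟩ := key Finset.univ
  refine ⟨p, hp, lt_of_le_of_lt ((dist_pi_le_iff (by positivity)).2 fun j => ?_) (half_lt_self hε)⟩
  rw [Real.dist_eq, abs_le]
  constructor <;> linarith [hle j, hlt j (Finset.mem_univ j)]

theorem exists_isLUB_of_isClosed_of_supClosed {P X : Set (Ω → ℝ)} (hc : IsClosed P)
    (hsup : SupClosed P) (hb : BddAbove P) (hXP : X ⊆ P) (hX : X.Nonempty) :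
    ∃ q ∈ P, IsLUB X q := by
  obtain ⟨q, hq, hglb⟩ := exists_isGLB_of_isClosed_of_infClosed (P := -P) (X := -X) hc.neg
    (fun a ha b hb' => by
      rw [Set.mem_neg, neg_inf]
      exact hsup ha hb') hb.neg (Set.neg_subset_neg.2 hXP) hX.neg
  exact ⟨-q, hq, by simpa using hglb.neg⟩

theorem formsCompleteLattice_of_isClosed {P : Set (Ω → ℝ)} (hc : IsClosed P)
    (hinf : InfClosed P) (hsup : SupClosed P) (hbelow : BddBelow P) (habove : BddAbove P)
    (hne : P.Nonempty) : FormsCompleteLattice P := by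
  have glb : ∀ X ⊆ P, X.Nonempty → ∃ q ∈ P, IsGLB X q :=
    fun X h h' => exists_isGLB_of_isClosed_of_infClosed hc hinf hbelow h h'
  have lub : ∀ X ⊆ P, X.Nonempty → ∃ q ∈ P, IsLUB X q :=
    fun X h h' => exists_isLUB_of_isClosed_of_supClosed hc hsup habove h h'
  refine ⟨fun X => ?_, fun X h h' => ⟨glb X h h', lub X h h'⟩⟩
  rcases X.eq_empty_or_nonempty with rfl | hX
  · obtain ⟨q, hq, hqg⟩ := glb P subset_rfl hne
    obtain ⟨s, hs, hsl⟩ := lub P subset_rfl hne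
    refine ⟨⟨⟨s, hs⟩, ?_⟩, ⟨⟨q, hq⟩, ?_⟩⟩
    · rw [isGLB_empty_iff]
      exact fun x => hsl.1 x.2
    · rw [isLUB_empty_iff]
      exact fun x => hqg.1 x.2
  · have himg : (Subtype.val '' X) ⊆ P := by
      rintro _ ⟨x, _, rfl⟩
      exact x.2
    obtain ⟨q, hq, hqg⟩ := glb _ himg (hX.image _)
    obtain ⟨s, hs, hsl⟩ := lub _ himg (hX.image _)
    exact ⟨⟨⟨q, hq⟩, fun x hx => hqg.1 ⟨x, hx, rfl⟩, fun y hy => hqg.2 (by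
        rintro _ ⟨x, hx, rfl⟩
        exact hy hx)⟩,
      ⟨⟨s, hs⟩, fun x hx => hsl.1 ⟨x, hx, rfl⟩, fun y hy => hsl.2 (by
        rintro _ ⟨x, hx, rfl⟩
        exact hy hx)⟩⟩

/-- Prices and allocations decouple: every r-WE price vector also supports the fixed allocation
`A₀`. -/
theorem IsReserveWE.setOf_prices_eq [Fintype B] {v : B → Finset Ω → ℝ}
    (hv : ∀ b, IsValuation (v b)) {r p₀ : Ω → ℝ} {A₀ : Allocation B Ω}
    (h₀ : IsReserveWE v r A₀ p₀) :
    {p : Ω → ℝ | ∃ A : Allocation B Ω, IsReserveWE v r A p} =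
      {p | r ≤ p ∧ dualObjective v p ≤ dualObjective v p₀} := by
  ext p
  constructor
  · rintro ⟨A, hA⟩
    refine ⟨hA.reserve_le, ?_⟩
    rw [hA.dualObjective_eq]
    exact reserveLPObjective_le_dualObjective hv h₀.reserve_le A.lpFeasible_toLP
  · rintro ⟨hp, hle⟩
    exact ⟨A₀, isReserveWE_of_dualObjective_le hp (hle.trans h₀.dualObjective_eq.le)⟩

theorem formsCompleteLattice_prices [Fintype B] {v : B → Finset Ω → ℝ}
    (hv : ∀ b, IsValuation (v b)) (hgs : ∀ b, GrossSubstitute (v b)) {r : Ω → ℝ} (hr : 0 ≤ r) :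
    FormsCompleteLattice {p : Ω → ℝ | ∃ A : Allocation B Ω, IsReserveWE v r A p} := by
  obtain ⟨A₀, p₀, h₀⟩ := exists_isReserveWE_of_grossSubstitute hv hgs hr
  have hmin : ∀ p, r ≤ p → dualObjective v p₀ ≤ dualObjective v p := fun p hp => by
    rw [h₀.dualObjective_eq]
    exact reserveLPObjective_le_dualObjective hv hp A₀.lpFeasible_toLP
  rw [h₀.setOf_prices_eq hv]
  refine formsCompleteLattice_of_isClosed ?_ ?_ ?_ ⟨r, fun p hp => hp.1⟩
    ⟨fun _ => dualObjective v p₀, fun p hp j => ?_⟩ ⟨p₀, h₀.reserve_le, le_rfl⟩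
  · exact isClosed_Ici.inter (isClosed_le (continuous_dualObjective v) continuous_const)
  · rintro p ⟨hp, hp'⟩ q ⟨hq, hq'⟩
    -- Meet and join are each at least the minimum and together at most twice it, so both attain it.
    have h1 := dualObjective_sup_add_inf_le hgs (hr.trans hp) (hr.trans hq)
    have h2 := hmin (p ⊔ q) (le_sup_of_le_left hp)
    exact ⟨le_inf hp hq, by linarith⟩
  · rintro p ⟨hp, hp'⟩ q ⟨hq, hq'⟩
    have h1 := dualObjective_sup_add_inf_le hgs (hr.trans hp) (hr.trans hq)
    have h2 := hmin (p ⊓ q) (le_inf hp hq)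
    exact ⟨le_sup_of_le_left hp, by linarith⟩
  -- Prices and indirect utilities are nonnegative, so each single price is at most the dual
  -- objective.
  · have h1 : p j ≤ ∑ i, p i := Finset.single_le_sum (f := p)
      (fun i _ => (hr i).trans (hp.1 i)) (Finset.mem_univ j)
    have h2 : 0 ≤ ∑ b, indirectUtility (v b) p :=
      Finset.sum_nonneg fun b _ => (hv b).indirectUtility_nonneg p
    have h3 := hp.2
    unfold dualObjective at h3 ⊢
    linarith

end Lattice

end Market

theorem mainTheorem3 {B Ω : Type*} [Fintype B] [Fintype Ω] [DecidableEq Ω]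
    (v : B → Finset Ω → ℝ) (hv : ∀ b, Market.IsValuation (v b))
    (r : Ω → ℝ) (hr : 0 ≤ r) :
    -- (a1)
    (∀ (A : Market.Allocation B Ω) (p : Ω → ℝ),
      Market.IsReserveWE v r A p ↔
        ∃ p' : Ω → ℝ, Market.IsWE (Market.extendValuations v r) A.extend p' ∧
          (∀ j, A.IsAllocated j → p j = p' j) ∧ (∀ j, ¬ A.IsAllocated j → p j = r j)) ∧
    -- (a2)
    (∀ A : Market.Allocation B Ω,
      (∃ p : Ω → ℝ, Market.IsReserveWE v r A p) ↔ Market.IsReserveLPOptimal v r A.toLP) ∧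
    -- (b)
    ((∀ b, Market.GrossSubstitute (v b)) →
      (∃ (A : Market.Allocation B Ω) (p : Ω → ℝ), Market.IsReserveWE v r A p) ∧
      Market.FormsCompleteLattice
        {p : Ω → ℝ | ∃ A : Market.Allocation B Ω, Market.IsReserveWE v r A p}) := by
  refine ⟨fun A p => ⟨fun h => ⟨p, h.extend hr, fun _ _ => rfl, h.unallocated⟩, ?_⟩,
    fun A => ⟨fun ⟨_, h⟩ => h.isReserveLPOptimal hv, fun h => h.exists_isReserveWE⟩,
    fun hgs => ⟨Market.exists_isReserveWE_of_grossSubstitute hv hgs hr,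
      Market.formsCompleteLattice_prices hv hgs hr⟩⟩
  rintro ⟨p', h, hp, hp'⟩
  exact h.isReserveWE hp hp'
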